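/- Let $\varphi\in C^2([0,1))$ be real-valued and suppose that $$\Omega=\{(z_1,z_2)\in\mathbb C^2:\ |z_1|<1,\ |z_2|<e^{-\varphi(|z_1|)}\}$$ is a complete pseudoconvex Reinhardt domain. Let $A^2(\Omega)$ be the Bergman space, that is, the space of holomorphic functions in $L^2(\Omega)$, and let $P:L^2(\Omega)\to A^2(\Omega)$ be the orthogonal projection. For $f\in A^2(\Omega)$ let $H_{\bar f}$ be the (possibly unbounded, densely defined) Hankel operator from $A^2(\Omega)$ to $L^2(\Omega)$ given by $H_{\bar f}(g)=(I-P)(\bar f g)$ for all $g\in A^2(\Omega)$ with $\bar f g\in L^2(\Omega)$. If $H_{\bar f}$ is Hilbert–Schmidt (that is, it extends to a bounded operator $T$ on $A^2(\Omega)$ with $\sum_j\|T\xi_j\|^2<\infty$ for some orthonormal basis $(\xi_j)$ of $A^2(\Omega)$), then $f$ is constant on $\Omega$. -/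

import Mathlib

open MeasureTheory

/-- The set `{(z₁, z₂) : |z₁| < 1, |z₂| < exp (-φ(|z₁|))}` in `ℂ²`. -/
def hartogsDomain (φ : ℝ → ℝ) : Set (ℂ × ℂ) :=
  {z | ‖z.1‖ < 1 ∧ ‖z.2‖ < Real.exp (-φ ‖z.1‖)}

/-- `Ω ⊆ ℂ²` is complete Reinhardt: with a point `z` it contains all points `w` with
`|w₁| ≤ |z₁|` and `|w₂| ≤ |z₂|`. -/
def IsCompleteReinhardt (Ω : Set (ℂ × ℂ)) : Prop :=
  ∀ z ∈ Ω, ∀ w : ℂ × ℂ, ‖w.1‖ ≤ ‖z.1‖ → ‖w.2‖ ≤ ‖z.2‖ → w ∈ Ω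

/-- A continuous real function `u` on `Ω ⊆ ℂ²` that is plurisubharmonic: it satisfies the sub-mean
value inequality on (the boundary of) every closed disc contained in `Ω` that lies in a
complex line. -/
def IsContinuousPlurisubharmonicOn (u : ℂ × ℂ → ℝ) (Ω : Set (ℂ × ℂ)) : Prop :=
  ContinuousOn u Ω ∧
    ∀ a b : ℂ × ℂ, (∀ ζ : ℂ, ‖ζ‖ ≤ 1 → a + ζ • b ∈ Ω) →
      u a ≤ Real.circleAverage (fun ζ : ℂ => u (a + ζ • b)) 0 1

/-- `Ω ⊆ ℂ²` is pseudoconvex: it is open and has a continuous plurisubharmonic exhaustion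
function. -/
def IsPseudoconvex (Ω : Set (ℂ × ℂ)) : Prop :=
  IsOpen Ω ∧ ∃ u : ℂ × ℂ → ℝ, IsContinuousPlurisubharmonicOn u Ω ∧
    ∀ c : ℝ, IsCompact {z ∈ Ω | u z ≤ c}

/-- `L²(Ω)`, with respect to Lebesgue measure on `ℂ² = ℝ⁴`. -/
abbrev L2Space (Ω : Set (ℂ × ℂ)) : Type :=
  Lp ℂ 2 ((volume : Measure (ℂ × ℂ)).restrict Ω)

/-- The function `f` is holomorphic and square integrable on `Ω`. -/
def MemBergman (Ω : Set (ℂ × ℂ)) (f : ℂ × ℂ → ℂ) : Prop :=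
  DifferentiableOn ℂ f Ω ∧ MemLp f 2 ((volume : Measure (ℂ × ℂ)).restrict Ω)

/-- The Bergman space `A²(Ω)`, as a subspace of `L²(Ω)`: the classes of square integrable
functions that have a holomorphic representative. -/
def bergmanSpace (Ω : Set (ℂ × ℂ)) : Submodule ℂ (L2Space Ω) where
  carrier := {g | ∃ F : ℂ × ℂ → ℂ, DifferentiableOn ℂ F Ω ∧
    g =ᵐ[(volume : Measure (ℂ × ℂ)).restrict Ω] F}
  add_mem' := by
    rintro a b ⟨F, hF, ha⟩ ⟨G, hG, hb⟩
    exact ⟨F + G, hF.add hG, (Lp.coeFn_add a b).trans (ha.add hb)⟩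
  zero_mem' := ⟨0, differentiableOn_const 0, Lp.coeFn_zero _ _ _⟩
  smul_mem' := by
    rintro c a ⟨F, hF, ha⟩
    exact ⟨c • F, hF.const_smul c, (Lp.coeFn_smul c a).trans (ha.const_smul c)⟩

/-- The Bergman projection `P`, the orthogonal projection of `L²(Ω)` onto `A²(Ω)`. For open `Ω` the
subspace `A²(Ω)` is closed in `L²(Ω)`; its closure is written only because Mathlib
defines orthogonal projections onto subspaces that are known to be complete. -/
noncomputable def bergmanProjection (Ω : Set (ℂ × ℂ)) : L2Space Ω →L[ℂ] L2Space Ω :=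
  (bergmanSpace Ω).topologicalClosure.starProjection

/-- The subspace `{g ∈ A²(Ω) : b g ∈ L²(Ω)}` of `A²(Ω)`. -/
def mulDomain (Ω : Set (ℂ × ℂ)) (b : ℂ × ℂ → ℂ) : Submodule ℂ (bergmanSpace Ω) where
  carrier := {g | MemLp (fun z => b z * (g : L2Space Ω) z) 2
    ((volume : Measure (ℂ × ℂ)).restrict Ω)}
  add_mem' := by
    intro g h hg hh
    refine MemLp.ae_eq ?_ (MemLp.add hg hh)
    filter_upwards [Lp.coeFn_add (g : L2Space Ω) (h : L2Space Ω)] with z hz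
    rw [Submodule.coe_add, hz, Pi.add_apply, Pi.add_apply, mul_add]
  zero_mem' := by
    refine MemLp.ae_eq ?_ (MemLp.zero (ε := ℂ))
    filter_upwards [Lp.coeFn_zero ℂ 2 ((volume : Measure (ℂ × ℂ)).restrict Ω)] with z hz
    rw [Submodule.coe_zero, hz, Pi.zero_apply, mul_zero]
  smul_mem' := by
    intro c g hg
    refine MemLp.ae_eq ?_ (MemLp.const_smul hg c)
    filter_upwards [Lp.coeFn_smul c (g : L2Space Ω)] with z hz
    rw [Submodule.coe_smul, hz, Pi.smul_apply, Pi.smul_apply, smul_eq_mul, smul_eq_mul,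
      mul_left_comm]

theorem memLp_of_mem_mulDomain {Ω : Set (ℂ × ℂ)} {b : ℂ × ℂ → ℂ} {g : bergmanSpace Ω}
    (hg : g ∈ mulDomain Ω b) :
    MemLp (fun z => b z * (g : L2Space Ω) z) 2 ((volume : Measure (ℂ × ℂ)).restrict Ω) := hg

/-- Multiplication by `b`, as a linear map from `{g ∈ A²(Ω) : b g ∈ L²(Ω)}` to `L²(Ω)`. -/
noncomputable def mulSymbol (Ω : Set (ℂ × ℂ)) (b : ℂ × ℂ → ℂ) :
    mulDomain Ω b →ₗ[ℂ] L2Space Ω where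
  toFun g := MemLp.toLp (fun z => b z * ((g : bergmanSpace Ω) : L2Space Ω) z)
    (memLp_of_mem_mulDomain g.2)
  map_add' := by
    intro g h
    refine Eq.trans ?_ (MemLp.toLp_add _ _)
    refine MemLp.toLp_congr _ _ ?_
    filter_upwards [Lp.coeFn_add ((g : bergmanSpace Ω) : L2Space Ω)
      ((h : bergmanSpace Ω) : L2Space Ω)] with z hz
    rw [Submodule.coe_add, Submodule.coe_add, hz, Pi.add_apply, Pi.add_apply, mul_add]
  map_smul' := by
    intro c g
    refine Eq.trans ?_ (MemLp.toLp_const_smul c _)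
    refine MemLp.toLp_congr _ _ ?_
    filter_upwards [Lp.coeFn_smul c ((g : bergmanSpace Ω) : L2Space Ω)] with z hz
    rw [Submodule.coe_smul, Submodule.coe_smul, hz, Pi.smul_apply, Pi.smul_apply, smul_eq_mul,
      smul_eq_mul, mul_left_comm]

/-- The Hankel operator `H_b g = (I - P)(b g)` with symbol `b`, a (possibly unbounded) operator from
`A²(Ω)` to `L²(Ω)` with its maximal domain `{g ∈ A²(Ω) : b g ∈ L²(Ω)}`. -/
noncomputable def hankelOperator (Ω : Set (ℂ × ℂ)) (b : ℂ × ℂ → ℂ) :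
    bergmanSpace Ω →ₗ.[ℂ] L2Space Ω where
  domain := mulDomain Ω b
  toFun := (LinearMap.id - (bergmanProjection Ω : L2Space Ω →ₗ[ℂ] L2Space Ω)) ∘ₗ mulSymbol Ω b

/-- A bounded operator `T` is Hilbert–Schmidt: there is an orthonormal (Hilbert) basis `ξ` with
`∑ ‖T ξⱼ‖² < ∞`. -/
def IsHilbertSchmidt {E F : Type} [NormedAddCommGroup E] [InnerProductSpace ℂ E]
    [NormedAddCommGroup F] [InnerProductSpace ℂ F] (T : E →L[ℂ] F) : Prop :=
  ∃ (ι : Type) (ξ : HilbertBasis ι ℂ E), Summable fun j => ‖T (ξ j)‖ ^ 2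

/-- A densely defined operator `H` is Hilbert–Schmidt: it is the restriction to its domain of
a bounded Hilbert–Schmidt operator `T` (which is unique because the domain is dense). -/
def IsHilbertSchmidtPartial {E F : Type} [NormedAddCommGroup E] [InnerProductSpace ℂ E]
    [NormedAddCommGroup F] [InnerProductSpace ℂ F] (H : E →ₗ.[ℂ] F) : Prop :=
  ∃ T : E →L[ℂ] F, (∀ g : H.domain, T (g : E) = H g) ∧ IsHilbertSchmidt T

/-!
The domain `Ω` is a bounded complete Reinhardt domain, so the monomials `z ^ α` are an orthogonal
family in `A²(Ω)`; write `n α` for the square of their norms. Let `c` be the coefficient of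
`z ^ γ` in `f`, with `γ ≠ 0`. The component of `conj f * z ^ α` of weight `α - γ` under the torus
action is `conj c * conj (z ^ γ) * z ^ α`. Its part orthogonal to `A²(Ω)` has square norm
`|c|² (n (α + γ) - n α ² / n (α - γ))`, where the second term is absent if `α ≱ γ`
(`norm_sq_hankelOperator_ge_of_not_le`, `norm_sq_hankelOperator_ge_of_add`).

Dividing by `n α` and summing along a chain `α = β + k γ`, `k ≤ K`, with `β ≱ γ`, the lower bounds
telescope to `|c|² n (β + (K + 1) γ) / n (β + K γ)`. Since `n (β + K γ)` grows at least like
`a ^ K`, with `a` half the value of `|z ^ γ|²` at a point of `Ω`, this quotient is at least `a / 2`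
for some `K` (`exists_pos_forall_exists_mul_le`). In dimension two there are infinitely many
chains (`exists_injective_chains`), so the Hilbert–Schmidt sum over the normalized monomials
diverges unless `c = 0`. This sum is bounded by the sum over any Hilbert basis
(`sum_norm_sq_le_of_hilbertBasis`). Hence only the constant coefficient of `f` survives, and `f` is
constant by uniqueness of Fourier coefficients on torus orbits.

Coefficients are extracted through Fourier coefficients along torus orbits (`weightComponent`),
which for a holomorphic function are multiples of monomials on all of `Ω`
(`exists_weightComponent_eq_monomial`); rotation invariance of Lebesgue measure and Fubini
turn these into statements on integrals over `Ω` (`HasWeight.integral_conj_mul`).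
-/

/-! ### Torus action and monomials -/

/-- The monomial `z ↦ z₁ ^ α₁ * z₂ ^ α₂`, for a multi-index `α`. -/
def monomial (α : Fin 2 → ℕ) (z : ℂ × ℂ) : ℂ := z.1 ^ α 0 * z.2 ^ α 1

/-- A multi-index, as a character of the torus. -/
def intIndex (α : Fin 2 → ℕ) : Fin 2 → ℤ := fun i => α i

/-- The action of the torus `(ℝ/ℤ)²` on `ℂ²` by rotation of the coordinates. -/
noncomputable def torusAct (t : UnitAddTorus (Fin 2)) (z : ℂ × ℂ) : ℂ × ℂ :=
  ((AddCircle.toCircle (t 0) : ℂ) * z.1, (AddCircle.toCircle (t 1) : ℂ) * z.2)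

/-- The normalized Haar measure on the torus `(ℝ/ℤ)²`. It is definitionally the measure used by
`UnitAddTorus.mFourierCoeff`, which comes from an instance local to that file of Mathlib. -/
noncomputable def torusMeasure : Measure (UnitAddTorus (Fin 2)) :=
  Measure.pi fun _ => AddCircle.haarAddCircle

/-- `h` transforms under the torus action by the character `δ`. -/
def HasWeight (δ : Fin 2 → ℤ) (h : ℂ × ℂ → ℂ) : Prop :=
  ∀ t z, h (torusAct t z) = UnitAddTorus.mFourier δ t * h z

/-- The component of weight `δ` of `g` under the torus action, that is, the `δ`-th Fourier
coefficient of `g` along torus orbits. -/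
noncomputable def weightComponent (g : ℂ × ℂ → ℂ) (δ : Fin 2 → ℤ) (z : ℂ × ℂ) : ℂ :=
  UnitAddTorus.mFourierCoeff (fun t => g (torusAct t z)) δ

theorem weightComponent_eq (g : ℂ × ℂ → ℂ) (δ : Fin 2 → ℤ) (z : ℂ × ℂ) :
    weightComponent g δ z =
      ∫ t, UnitAddTorus.mFourier (-δ) t * g (torusAct t z) ∂torusMeasure := rfl

instance : IsProbabilityMeasure torusMeasure := by
  unfold torusMeasure; infer_instance

theorem continuous_monomial (α : Fin 2 → ℕ) : Continuous (monomial α) := by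
  unfold monomial; fun_prop

theorem differentiable_monomial (α : Fin 2 → ℕ) : Differentiable ℂ (monomial α) := by
  unfold monomial; fun_prop

theorem monomial_add (α β : Fin 2 → ℕ) (z : ℂ × ℂ) :
    monomial (α + β) z = monomial α z * monomial β z := by
  simp only [monomial, Pi.add_apply, pow_add]; ring

theorem monomial_nsmul (k : ℕ) (α : Fin 2 → ℕ) (z : ℂ × ℂ) :
    monomial (k • α) z = monomial α z ^ k := by
  simp only [monomial, Pi.smul_apply, smul_eq_mul, mul_pow, ← pow_mul, mul_comm]

theorem monomial_ne_zero (α : Fin 2 → ℕ) {z : ℂ × ℂ} (h₁ : z.1 ≠ 0) (h₂ : z.2 ≠ 0) :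
    monomial α z ≠ 0 := mul_ne_zero (pow_ne_zero _ h₁) (pow_ne_zero _ h₂)

theorem continuous_torusAct :
    Continuous fun p : UnitAddTorus (Fin 2) × (ℂ × ℂ) => torusAct p.1 p.2 := by
  unfold torusAct
  have := AddCircle.continuous_toCircle (T := 1)
  fun_prop

theorem norm_torusAct_fst (t : UnitAddTorus (Fin 2)) (z : ℂ × ℂ) :
    ‖(torusAct t z).1‖ = ‖z.1‖ := by
  simp only [torusAct, norm_mul, Circle.norm_coe, one_mul]

theorem norm_torusAct_snd (t : UnitAddTorus (Fin 2)) (z : ℂ × ℂ) :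
    ‖(torusAct t z).2‖ = ‖z.2‖ := by
  simp only [torusAct, norm_mul, Circle.norm_coe, one_mul]

theorem torusAct_zero (z : ℂ × ℂ) : torusAct 0 z = z := by
  simp [torusAct]

theorem hasWeight_monomial (α : Fin 2 → ℕ) : HasWeight (intIndex α) (monomial α) := by
  intro t z
  simp only [monomial, torusAct, UnitAddTorus.mFourier, ContinuousMap.coe_mk, intIndex,
    Fin.prod_univ_two, fourier_apply, mul_pow, AddCircle.toCircle_zsmul, zpow_natCast,
    Circle.coe_pow]
  ring

theorem HasWeight.mul {δ ε : Fin 2 → ℤ} {g h : ℂ × ℂ → ℂ} (hg : HasWeight δ g)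
    (hh : HasWeight ε h) : HasWeight (δ + ε) fun z => g z * h z := by
  intro t z
  simp only [hg t z, hh t z, UnitAddTorus.mFourier_add]; ring

theorem HasWeight.conj {δ : Fin 2 → ℤ} {g : ℂ × ℂ → ℂ} (hg : HasWeight δ g) :
    HasWeight (-δ) fun z => (starRingEnd ℂ) (g z) := by
  intro t z
  simp only [hg t z, UnitAddTorus.mFourier_neg, map_mul]

theorem HasWeight.const_mul {δ : Fin 2 → ℤ} {g : ℂ × ℂ → ℂ} (hg : HasWeight δ g) (c : ℂ) :
    HasWeight δ fun z => c * g z := by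
  intro t z
  simp only [hg t z]; ring

theorem HasWeight.sub {δ : Fin 2 → ℤ} {g h : ℂ × ℂ → ℂ} (hg : HasWeight δ g)
    (hh : HasWeight δ h) : HasWeight δ fun z => g z - h z := by
  intro t z
  simp only [hg t z, hh t z]; ring

/-! ### Averaging over torus orbits -/

theorem IsCompleteReinhardt.torusAct_mem_iff {Ω : Set (ℂ × ℂ)} (hR : IsCompleteReinhardt Ω)
    (t : UnitAddTorus (Fin 2)) (z : ℂ × ℂ) : torusAct t z ∈ Ω ↔ z ∈ Ω :=
  ⟨fun h => hR _ h _ (norm_torusAct_fst t z).ge (norm_torusAct_snd t z).ge,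
    fun h => hR _ h _ (norm_torusAct_fst t z).le (norm_torusAct_snd t z).le⟩

theorem measurePreserving_torusAct (t : UnitAddTorus (Fin 2)) :
    MeasurePreserving (torusAct t) (volume : Measure (ℂ × ℂ)) volume :=
  ((rotation (AddCircle.toCircle (t 0))).measurePreserving).prod
    ((rotation (AddCircle.toCircle (t 1))).measurePreserving)

theorem measurePreserving_torusAct_restrict {Ω : Set (ℂ × ℂ)} (hR : IsCompleteReinhardt Ω)
    (hΩ : MeasurableSet Ω) (t : UnitAddTorus (Fin 2)) :
    MeasurePreserving (torusAct t) ((volume : Measure (ℂ × ℂ)).restrict Ω)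
      ((volume : Measure (ℂ × ℂ)).restrict Ω) := by
  have h := (measurePreserving_torusAct t).restrict_preimage hΩ
  rwa [show torusAct t ⁻¹' Ω = Ω from Set.ext fun z => hR.torusAct_mem_iff t z] at h

theorem integral_eq_integral_torus_average {Ω : Set (ℂ × ℂ)} (hR : IsCompleteReinhardt Ω)
    (hΩ : MeasurableSet Ω) {F : ℂ × ℂ → ℂ} (hF : IntegrableOn F Ω) :
    ∫ z in Ω, F z = ∫ z in Ω, ∫ t, F (torusAct t z) ∂torusMeasure := by
  set μ := (volume : Measure (ℂ × ℂ)).restrict Ω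
  have hmp : MeasurePreserving
      (fun p : UnitAddTorus (Fin 2) × (ℂ × ℂ) => (p.1, torusAct p.1 p.2))
      (torusMeasure.prod μ) (torusMeasure.prod μ) :=
    (MeasurePreserving.id torusMeasure).skew_product
      (g := torusAct) continuous_torusAct.measurable
      (Filter.Eventually.of_forall fun t =>
        (measurePreserving_torusAct_restrict hR hΩ t).map_eq)
  have hint : Integrable (fun p : UnitAddTorus (Fin 2) × (ℂ × ℂ) => F (torusAct p.1 p.2))
      (torusMeasure.prod μ) :=
    hmp.integrable_comp_of_integrable (hF.comp_snd torusMeasure)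
  have h1 := integral_integral_swap (f := fun t z => F (torusAct t z)) hint
  rw [← h1]
  have h2 : ∀ t, ∫ z, F (torusAct t z) ∂μ = ∫ z, F z ∂μ := by
    intro t
    have hm := measurePreserving_torusAct_restrict hR hΩ t
    have hF' : AEStronglyMeasurable F (Measure.map (torusAct t) μ) := by
      rw [hm.map_eq]; exact hF.1
    have := integral_map hm.measurable.aemeasurable hF'
    rw [hm.map_eq] at this
    exact this.symm
  simp_rw [h2]
  simp

/-- Pairing with a function of weight `δ` only sees the component of weight `δ`. -/
theorem HasWeight.integral_conj_mul {Ω : Set (ℂ × ℂ)} (hR : IsCompleteReinhardt Ω)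
    (hΩ : MeasurableSet Ω) {δ : Fin 2 → ℤ} {h g : ℂ × ℂ → ℂ} (hh : HasWeight δ h)
    (hint : IntegrableOn (fun z => (starRingEnd ℂ) (h z) * g z) Ω) :
    ∫ z in Ω, (starRingEnd ℂ) (h z) * g z =
      ∫ z in Ω, (starRingEnd ℂ) (h z) * weightComponent g δ z := by
  rw [integral_eq_integral_torus_average hR hΩ hint]
  refine integral_congr_ae (Filter.Eventually.of_forall fun z => ?_)
  simp only [weightComponent_eq]
  rw [← integral_const_mul]
  congr 1
  ext t
  have h1 := hh.conj t z
  simp only at h1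
  rw [h1]; ring

theorem integral_mFourier {δ : Fin 2 → ℤ} (hδ : δ ≠ 0) :
    ∫ t, UnitAddTorus.mFourier δ t ∂torusMeasure = 0 := by
  obtain ⟨i, hi⟩ := Function.ne_iff.mp hδ
  have := integral_fintype_prod_eq_prod (μ := fun _ : Fin 2 => AddCircle.haarAddCircle (T := 1))
    (f := fun i (x : UnitAddCircle) => fourier (δ i) x)
  refine this.trans (Finset.prod_eq_zero (Finset.mem_univ i) ?_)
  have h := fourierCoeff_fourier (T := 1) (δ i)
  have h0 := congrFun h 0
  rw [Pi.single_eq_of_ne (by simpa using Ne.symm hi)] at h0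
  simpa [fourierCoeff] using h0

theorem HasWeight.integral_conj_mul_eq_zero {Ω : Set (ℂ × ℂ)} (hR : IsCompleteReinhardt Ω)
    (hΩ : MeasurableSet Ω) {δ ε : Fin 2 → ℤ} (hne : δ ≠ ε) {h g : ℂ × ℂ → ℂ}
    (hh : HasWeight δ h) (hg : HasWeight ε g)
    (hint : IntegrableOn (fun z => (starRingEnd ℂ) (h z) * g z) Ω) :
    ∫ z in Ω, (starRingEnd ℂ) (h z) * g z = 0 := by
  rw [hh.integral_conj_mul hR hΩ hint]
  have : ∀ z, weightComponent g δ z = 0 := by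
    intro z
    simp only [weightComponent_eq, hg _ z, ← mul_assoc, ← UnitAddTorus.mFourier_add]
    rw [integral_mul_const, integral_mFourier, zero_mul]
    intro h0
    exact hne (neg_add_eq_zero.mp h0)
  simp [this]

/-! ### Hilbert–Schmidt operators -/

theorem ofReal_norm_sq_eq_tsum_inner {ι E : Type*} [NormedAddCommGroup E] [InnerProductSpace ℂ E]
    (b : HilbertBasis ι ℂ E) (x : E) :
    ENNReal.ofReal (‖x‖ ^ 2) = ∑' i, ENNReal.ofReal (‖inner ℂ (b i) x‖ ^ 2) := by
  have h := (b.hasSum_inner_mul_inner x x).mapL Complex.reCLM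
  have h2 : HasSum (fun i => ‖inner ℂ (b i) x‖ ^ 2) (‖x‖ ^ 2) := by
    convert h using 1
    · ext i
      rw [← inner_conj_symm x (b i), ← Complex.normSq_eq_conj_mul_self]
      rw [Complex.normSq_eq_norm_sq]; rfl
    · simp [inner_self_eq_norm_sq_to_K, ← Complex.ofReal_pow]
  rw [← h2.tsum_eq, ENNReal.ofReal_tsum_of_nonneg (fun i => by positivity) h2.summable]

/-- The Hilbert–Schmidt sum over any finite orthonormal family is bounded by the sum over a
Hilbert basis: both are compared with the Hilbert–Schmidt sum of the adjoint. -/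
theorem sum_norm_sq_le_of_hilbertBasis {ι κ E F : Type*} [NormedAddCommGroup E]
    [InnerProductSpace ℂ E] [NormedAddCommGroup F] [InnerProductSpace ℂ F] [CompleteSpace F]
    (T : E →L[ℂ] F) (ξ : HilbertBasis ι ℂ E) (hT : Summable fun j => ‖T (ξ j)‖ ^ 2)
    {e : κ → E} (he : Orthonormal ℂ e) (s : Finset κ) :
    ∑ k ∈ s, ‖T (e k)‖ ^ 2 ≤ ∑' j, ‖T (ξ j)‖ ^ 2 := by
  have : CompleteSpace E :=
    (completeSpace_congr ξ.repr.toIsometryEquiv.isometry.isUniformEmbedding).mpr inferInstance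
  obtain ⟨w, η, -⟩ := exists_hilbertBasis ℂ F
  have hb : ∀ x : E, ENNReal.ofReal (‖T x‖ ^ 2) =
      ∑' i, ENNReal.ofReal (‖inner ℂ x (T.adjoint (η i))‖ ^ 2) := by
    intro x
    rw [ofReal_norm_sq_eq_tsum_inner η (T x)]
    refine tsum_congr fun i => ?_
    rw [T.adjoint_inner_right, norm_inner_symm]
  have key : ENNReal.ofReal (∑ k ∈ s, ‖T (e k)‖ ^ 2) ≤ ENNReal.ofReal (∑' j, ‖T (ξ j)‖ ^ 2) := by
    calc ENNReal.ofReal (∑ k ∈ s, ‖T (e k)‖ ^ 2)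
        = ∑ k ∈ s, ∑' i, ENNReal.ofReal (‖inner ℂ (e k) (T.adjoint (η i))‖ ^ 2) := by
          rw [ENNReal.ofReal_sum_of_nonneg fun i _ => by positivity]
          simp_rw [hb]
      _ = ∑' i, ∑ k ∈ s, ENNReal.ofReal (‖inner ℂ (e k) (T.adjoint (η i))‖ ^ 2) :=
          (Summable.tsum_finsetSum fun _ _ => ENNReal.summable).symm
      _ ≤ ∑' i, ENNReal.ofReal (‖T.adjoint (η i)‖ ^ 2) := by
          refine ENNReal.tsum_le_tsum fun i => ?_
          rw [← ENNReal.ofReal_sum_of_nonneg fun i _ => by positivity]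
          exact ENNReal.ofReal_le_ofReal (he.sum_inner_products_le _)
      _ = ∑' i, ∑' j, ENNReal.ofReal (‖inner ℂ (ξ j) (T.adjoint (η i))‖ ^ 2) :=
          tsum_congr fun i => ofReal_norm_sq_eq_tsum_inner ξ _
      _ = ∑' j, ∑' i, ENNReal.ofReal (‖inner ℂ (ξ j) (T.adjoint (η i))‖ ^ 2) :=
          ENNReal.tsum_comm
      _ = ENNReal.ofReal (∑' j, ‖T (ξ j)‖ ^ 2) := by
          rw [ENNReal.ofReal_tsum_of_nonneg (fun i => by positivity) hT]
          exact tsum_congr fun j => (hb _).symm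
  exact (ENNReal.ofReal_le_ofReal_iff (tsum_nonneg fun j => by positivity)).mp key

/-! ### Weight components of holomorphic functions -/

/-- The Fourier coefficients of a power series along the circle through `z` are its terms at `z`. -/
theorem hasSum_fourierCoeff_of_hasSum {h : ℂ → ℂ} {R : ℝ} {z : ℂ} {a : ℕ → ℂ}
    (hs : ∀ w : ℂ, ‖w‖ < R → HasSum (fun k : ℕ => a k * w ^ k) (h w)) (hz : ‖z‖ < R) (m : ℤ) :
    HasSum (fun k : ℕ => (a k * z ^ k) * (Pi.single (k : ℤ) (1 : ℂ) : ℤ → ℂ) m)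
      (fourierCoeff (fun t : UnitAddCircle => h (AddCircle.toCircle t * z)) m) := by
  have hsum := (hs z hz).summable.norm
  have hterm : ∀ (k : ℕ) (t : UnitAddCircle),
      fourier (-m) t * (a k * (AddCircle.toCircle t * z) ^ k) =
        (a k * z ^ k) * (fourier (-m) t * fourier (k : ℤ) t) := by
    intro k t
    rw [fourier_apply (n := (k : ℤ)), AddCircle.toCircle_zsmul, zpow_natCast, Circle.coe_pow, mul_pow]
    ring
  have hF := hasSum_integral_of_summable_integral_norm (μ := AddCircle.haarAddCircle (T := 1))
    (F := fun (k : ℕ) (t : UnitAddCircle) =>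
      fourier (-m) t * (a k * (AddCircle.toCircle t * z) ^ k))
    (fun k => by
      refine Continuous.integrable_of_hasCompactSupport ?_ (HasCompactSupport.of_compactSpace _)
      have := AddCircle.continuous_toCircle (T := 1)
      fun_prop)
    (by
      refine hsum.congr fun k => ?_
      simp only [norm_mul, norm_pow, Circle.norm_coe, one_mul, fourier_apply]
      simp)
  convert! hF using 1
  · ext k
    simp_rw [hterm]
    rw [integral_const_mul, ← fourierCoeff_fourier (T := 1)]
    simp only [fourierCoeff, smul_eq_mul]
  · refine integral_congr_ae (Filter.Eventually.of_forall fun t => ?_)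
    beta_reduce
    rw [tsum_mul_left, (hs _ (by simpa only [norm_mul, Circle.norm_coe, one_mul] using hz)).tsum_eq,
      smul_eq_mul]

theorem hasSum_taylor_of_differentiableOn {h : ℂ → ℂ} {R : ℝ}
    (hd : DifferentiableOn ℂ h (Metric.ball 0 R)) {w : ℂ} (hw : ‖w‖ < R) :
    HasSum (fun k : ℕ => ((k.factorial : ℂ)⁻¹ * iteratedDeriv k h 0) * w ^ k) (h w) := by
  have := Complex.hasSum_taylorSeries_on_ball hd (z := w) (by simpa using hw)
  simp only [sub_zero, smul_eq_mul] at this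
  simpa only [mul_assoc, mul_comm (w ^ _)] using this

theorem fourierCoeff_circle_natCast {h : ℂ → ℂ} {R : ℝ} {z : ℂ}
    (hd : DifferentiableOn ℂ h (Metric.ball 0 R)) (hz : ‖z‖ < R) (n : ℕ) :
    fourierCoeff (fun t : UnitAddCircle => h (AddCircle.toCircle t * z)) n =
      ((n.factorial : ℂ)⁻¹ * iteratedDeriv n h 0) * z ^ n := by
  refine (hasSum_fourierCoeff_of_hasSum
    (fun _ => hasSum_taylor_of_differentiableOn hd) hz n).unique ?_
  convert hasSum_single n ?_ using 1
  · simp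
  · intro k hk
    rw [Pi.single_eq_of_ne (by exact_mod_cast hk.symm), mul_zero]

theorem fourierCoeff_circle_of_neg {h : ℂ → ℂ} {R : ℝ} {z : ℂ}
    (hd : DifferentiableOn ℂ h (Metric.ball 0 R)) (hz : ‖z‖ < R) {m : ℤ} (hm : m < 0) :
    fourierCoeff (fun t : UnitAddCircle => h (AddCircle.toCircle t * z)) m = 0 := by
  refine (hasSum_fourierCoeff_of_hasSum
    (fun _ => hasSum_taylor_of_differentiableOn hd) hz m).unique ?_
  convert hasSum_zero using 2 with k
  rw [Pi.single_eq_of_ne (by omega), mul_zero]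

theorem integrable_weightComponent_integrand {g : ℂ × ℂ → ℂ} {z : ℂ × ℂ}
    (hg : Continuous fun t => g (torusAct t z)) (δ : Fin 2 → ℤ) :
    Integrable (fun p : UnitAddCircle × UnitAddCircle =>
      fourier (-δ 0) p.1 * (fourier (-δ 1) p.2 *
        g (AddCircle.toCircle p.1 * z.1, AddCircle.toCircle p.2 * z.2)))
      (AddCircle.haarAddCircle.prod AddCircle.haarAddCircle) := by
  refine Continuous.integrable_of_hasCompactSupport ?_ (HasCompactSupport.of_compactSpace _)
  have h2 : Continuous fun p : UnitAddCircle × UnitAddCircle => g (torusAct ![p.1, p.2] z) :=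
    hg.comp (by fun_prop)
  simp only [torusAct, Matrix.cons_val_zero, Matrix.cons_val_one] at h2
  exact ((fourier (-δ 0)).continuous.comp continuous_fst).mul
    (((fourier (-δ 1)).continuous.comp continuous_snd).mul h2)

theorem weightComponent_eq_integral_prod (g : ℂ × ℂ → ℂ) (z : ℂ × ℂ) (δ : Fin 2 → ℤ) :
    weightComponent g δ z = ∫ p : UnitAddCircle × UnitAddCircle,
      fourier (-δ 0) p.1 * (fourier (-δ 1) p.2 *
        g (AddCircle.toCircle p.1 * z.1, AddCircle.toCircle p.2 * z.2))
      ∂(AddCircle.haarAddCircle.prod AddCircle.haarAddCircle) := by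
  rw [← (measurePreserving_finTwoArrow (AddCircle.haarAddCircle (T := 1))).integral_comp',
    weightComponent_eq]
  refine integral_congr_ae (Filter.Eventually.of_forall fun t => ?_)
  simp [UnitAddTorus.mFourier, torusAct, Fin.prod_univ_two, mul_assoc]

theorem weightComponent_eq_fourierCoeff_fst {g : ℂ × ℂ → ℂ} {z : ℂ × ℂ}
    (hg : Continuous fun t => g (torusAct t z)) (δ : Fin 2 → ℤ) :
    weightComponent g δ z = fourierCoeff (fun s : UnitAddCircle =>
      fourierCoeff (fun r : UnitAddCircle =>
        g (AddCircle.toCircle r * z.1, AddCircle.toCircle s * z.2)) (δ 0)) (δ 1) := by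
  rw [weightComponent_eq_integral_prod,
    integral_prod_symm _ (integrable_weightComponent_integrand hg δ)]
  simp only [fourierCoeff, smul_eq_mul, ← integral_const_mul]
  simp only [mul_left_comm]

theorem weightComponent_eq_fourierCoeff_snd {g : ℂ × ℂ → ℂ} {z : ℂ × ℂ}
    (hg : Continuous fun t => g (torusAct t z)) (δ : Fin 2 → ℤ) :
    weightComponent g δ z = fourierCoeff (fun r : UnitAddCircle =>
      fourierCoeff (fun s : UnitAddCircle =>
        g (AddCircle.toCircle r * z.1, AddCircle.toCircle s * z.2)) (δ 1)) (δ 0) := by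
  rw [weightComponent_eq_integral_prod,
    integral_prod _ (integrable_weightComponent_integrand hg δ)]
  simp only [fourierCoeff, smul_eq_mul, ← integral_const_mul]

section Slices

variable {Ω : Set (ℂ × ℂ)}

theorem IsCompleteReinhardt.exists_ball_subset_fst (hR : IsCompleteReinhardt Ω) (hΩ : IsOpen Ω)
    {z : ℂ × ℂ} (hz : z ∈ Ω) :
    ∃ R, ‖z.1‖ < R ∧ ∀ w ∈ Metric.ball (0 : ℂ) R, (w, z.2) ∈ Ω := by
  have h0 : ((‖z.1‖ : ℂ), z.2) ∈ Ω := hR z hz _ (by simp) le_rfl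
  have hO : IsOpen {r : ℝ | ((r : ℂ), z.2) ∈ Ω} :=
    hΩ.preimage (f := fun r : ℝ => ((r : ℂ), z.2)) (by fun_prop)
  obtain ⟨ε, hε, hsub⟩ := Metric.isOpen_iff.mp hO _ h0
  refine ⟨‖z.1‖ + ε / 2, by linarith, fun w hw => ?_⟩
  have h2 : (((‖z.1‖ + ε / 2 : ℝ) : ℂ), z.2) ∈ Ω :=
    hsub (by rw [Metric.mem_ball, Real.dist_eq, add_sub_cancel_left, abs_of_pos] <;> linarith)
  refine hR _ h2 _ ?_ le_rfl
  rw [Complex.norm_real, Real.norm_of_nonneg (by positivity)]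
  exact (mem_ball_zero_iff.mp hw).le

theorem IsCompleteReinhardt.swap (hR : IsCompleteReinhardt Ω) :
    IsCompleteReinhardt (Prod.swap ⁻¹' Ω) :=
  fun z hz w h₁ h₂ => hR z.swap hz w.swap h₂ h₁

theorem IsCompleteReinhardt.exists_ball_subset_snd (hR : IsCompleteReinhardt Ω) (hΩ : IsOpen Ω)
    {z : ℂ × ℂ} (hz : z ∈ Ω) :
    ∃ R, ‖z.2‖ < R ∧ ∀ w ∈ Metric.ball (0 : ℂ) R, (z.1, w) ∈ Ω :=
  hR.swap.exists_ball_subset_fst (hΩ.preimage continuous_swap) (z := z.swap) hz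

theorem IsCompleteReinhardt.continuous_torus_orbit (hR : IsCompleteReinhardt Ω)
    {g : ℂ × ℂ → ℂ} (hg : DifferentiableOn ℂ g Ω) {z : ℂ × ℂ} (hz : z ∈ Ω) :
    Continuous fun t => g (torusAct t z) :=
  hg.continuousOn.comp_continuous
    (continuous_torusAct.comp (by fun_prop : Continuous fun t => (t, z)))
    fun t => (hR.torusAct_mem_iff t z).mpr hz

theorem weightComponent_eq_zero_of_neg (hR : IsCompleteReinhardt Ω) (hΩ : IsOpen Ω)
    {g : ℂ × ℂ → ℂ} (hg : DifferentiableOn ℂ g Ω) {δ : Fin 2 → ℤ} (hδ : ∃ i, δ i < 0)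
    {z : ℂ × ℂ} (hz : z ∈ Ω) : weightComponent g δ z = 0 := by
  have hc := hR.continuous_torus_orbit hg hz
  obtain ⟨i, hi⟩ := hδ
  fin_cases i
  · rw [weightComponent_eq_fourierCoeff_fst hc]
    have : ∀ s : UnitAddCircle, fourierCoeff (fun r : UnitAddCircle =>
        g (AddCircle.toCircle r * z.1, AddCircle.toCircle s * z.2)) (δ 0) = 0 := by
      intro s
      obtain ⟨R, hzR, hsub⟩ := hR.exists_ball_subset_fst hΩ
        (hR z hz (z.1, AddCircle.toCircle s * z.2) le_rfl
          (by simp only [norm_mul, Circle.norm_coe, one_mul, le_refl]))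
      exact fourierCoeff_circle_of_neg (h := fun w => g (w, AddCircle.toCircle s * z.2))
        (hg.comp (by fun_prop) hsub) hzR hi
    simp_rw [this]
    simp [fourierCoeff]
  · rw [weightComponent_eq_fourierCoeff_snd hc]
    have : ∀ s : UnitAddCircle, fourierCoeff (fun r : UnitAddCircle =>
        g (AddCircle.toCircle s * z.1, AddCircle.toCircle r * z.2)) (δ 1) = 0 := by
      intro s
      obtain ⟨R, hzR, hsub⟩ := hR.exists_ball_subset_snd hΩ
        (hR z hz (AddCircle.toCircle s * z.1, z.2)
          (by simp only [norm_mul, Circle.norm_coe, one_mul, le_refl]) le_rfl)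
      exact fourierCoeff_circle_of_neg (h := fun w => g (AddCircle.toCircle s * z.1, w))
        (hg.comp (by fun_prop) hsub) hzR hi
    simp_rw [this]
    simp [fourierCoeff]

/-- The factor `A` is an average over a circle of Taylor coefficients at `0` in the first variable,
hence does not depend on `z.1`. -/
theorem exists_weightComponent_eq_fst (hR : IsCompleteReinhardt Ω) (hΩ : IsOpen Ω)
    {g : ℂ × ℂ → ℂ} (hg : DifferentiableOn ℂ g Ω) (γ : Fin 2 → ℕ) :
    ∃ A : ℂ → ℂ, ∀ z ∈ Ω, weightComponent g (intIndex γ) z = z.1 ^ γ 0 * A z.2 := by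
  refine ⟨fun w => fourierCoeff (fun s : UnitAddCircle => (((γ 0).factorial : ℂ)⁻¹ *
    iteratedDeriv (γ 0) (fun v => g (v, AddCircle.toCircle s * w)) 0)) (γ 1), fun z hz => ?_⟩
  rw [weightComponent_eq_fourierCoeff_fst (hR.continuous_torus_orbit hg hz),
    ← fourierCoeff.const_mul]
  congr 1
  ext s
  obtain ⟨R, hzR, hsub⟩ := hR.exists_ball_subset_fst hΩ
    (hR z hz (z.1, AddCircle.toCircle s * z.2) le_rfl
      (by simp only [norm_mul, Circle.norm_coe, one_mul, le_refl]))
  refine Eq.trans ?_ (mul_comm _ _)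
  exact fourierCoeff_circle_natCast (h := fun w => g (w, AddCircle.toCircle s * z.2))
    (hg.comp (by fun_prop) hsub) hzR _

theorem exists_weightComponent_eq_snd (hR : IsCompleteReinhardt Ω) (hΩ : IsOpen Ω)
    {g : ℂ × ℂ → ℂ} (hg : DifferentiableOn ℂ g Ω) (γ : Fin 2 → ℕ) :
    ∃ B : ℂ → ℂ, ∀ z ∈ Ω, weightComponent g (intIndex γ) z = z.2 ^ γ 1 * B z.1 := by
  refine ⟨fun w => fourierCoeff (fun s : UnitAddCircle => (((γ 1).factorial : ℂ)⁻¹ *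
    iteratedDeriv (γ 1) (fun v => g (AddCircle.toCircle s * w, v)) 0)) (γ 0), fun z hz => ?_⟩
  rw [weightComponent_eq_fourierCoeff_snd (hR.continuous_torus_orbit hg hz),
    ← fourierCoeff.const_mul]
  congr 1
  ext s
  obtain ⟨R, hzR, hsub⟩ := hR.exists_ball_subset_snd hΩ
    (hR z hz (AddCircle.toCircle s * z.1, z.2)
      (by simp only [norm_mul, Circle.norm_coe, one_mul, le_refl]) le_rfl)
  refine Eq.trans ?_ (mul_comm _ _)
  exact fourierCoeff_circle_natCast (h := fun w => g (AddCircle.toCircle s * z.1, w))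
    (hg.comp (by fun_prop) hsub) hzR _

theorem IsCompleteReinhardt.exists_diagonal_mem (hR : IsCompleteReinhardt Ω) (hΩ : IsOpen Ω)
    (hne : Ω.Nonempty) : ∃ r : ℝ, 0 < r ∧ ((r : ℂ), (r : ℂ)) ∈ Ω := by
  obtain ⟨z, hz⟩ := hne
  have h0 : (((0 : ℝ) : ℂ), ((0 : ℝ) : ℂ)) ∈ Ω := hR z hz _ (by simp) (by simp)
  have hO : IsOpen {r : ℝ | ((r : ℂ), (r : ℂ)) ∈ Ω} :=
    hΩ.preimage (f := fun r : ℝ => ((r : ℂ), (r : ℂ))) (by fun_prop)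
  obtain ⟨ε, hε, hsub⟩ := Metric.isOpen_iff.mp hO _ h0
  exact ⟨ε / 2, by linarith, hsub (by
    rw [Metric.mem_ball, Real.dist_eq, sub_zero, abs_of_pos] <;> linarith)⟩

/-- The component of weight `γ` of a holomorphic function is a multiple of the monomial `z ^ γ`:
the one-variable Taylor formula in each variable gives `z₁ ^ γ₁ A(z₂)` and `z₂ ^ γ₂ B(z₁)`, and
comparing the two at points close to the axes shows that `A` is a multiple of `z₂ ^ γ₂`. -/
theorem exists_weightComponent_eq_monomial (hR : IsCompleteReinhardt Ω) (hΩ : IsOpen Ω)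
    {g : ℂ × ℂ → ℂ} (hg : DifferentiableOn ℂ g Ω) (γ : Fin 2 → ℕ) :
    ∃ c : ℂ, ∀ z ∈ Ω, weightComponent g (intIndex γ) z = c * monomial γ z := by
  rcases Ω.eq_empty_or_nonempty with rfl | hne
  · exact ⟨0, fun z hz => hz.elim⟩
  obtain ⟨A, hA⟩ := exists_weightComponent_eq_fst hR hΩ hg γ
  obtain ⟨B, hB⟩ := exists_weightComponent_eq_snd hR hΩ hg γ
  obtain ⟨r, hr, hrΩ⟩ := hR.exists_diagonal_mem hΩ hne
  have hr0 : (r : ℂ) ≠ 0 := by exact_mod_cast hr.ne'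
  refine ⟨A r / r ^ γ 1, fun z hz => ?_⟩
  obtain ⟨R, hzR, hsub⟩ := hR.exists_ball_subset_fst hΩ hz
  have hRpos : 0 < R := (norm_nonneg _).trans_lt hzR
  -- The torus of radii `(q, |z₂|)` and the torus of radii `(q, r)` both lie in `Ω`.
  set q : ℝ := min r (R / 2) with hq
  have hqpos : 0 < q := lt_min hr (by linarith)
  have hq0 : (q : ℂ) ≠ 0 := by exact_mod_cast hqpos.ne'
  have h1 : ((q : ℂ), z.2) ∈ Ω := hsub _ (by
    rw [mem_ball_zero_iff, Complex.norm_real, Real.norm_of_nonneg hqpos.le]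
    exact (min_le_right _ _).trans_lt (by linarith))
  have h2 : ((q : ℂ), (r : ℂ)) ∈ Ω := hR _ hrΩ _ (by
    rw [Complex.norm_real, Complex.norm_real, Real.norm_of_nonneg hqpos.le,
      Real.norm_of_nonneg hr.le]
    exact min_le_left _ _) le_rfl
  have e1 := (hA _ h1).symm.trans (hB _ h1)
  have e2 := (hA _ h2).symm.trans (hB _ h2)
  simp only at e1 e2
  have e3 : A z.2 * r ^ γ 1 = z.2 ^ γ 1 * A r := by
    refine mul_left_cancel₀ (pow_ne_zero (γ 0) hq0) ?_
    linear_combination (r : ℂ) ^ γ 1 * e1 - z.2 ^ γ 1 * e2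
  rw [hA z hz, monomial, div_mul_eq_mul_div, eq_div_iff (pow_ne_zero _ hr0)]
  linear_combination z.1 ^ γ 0 * e3

/-- A holomorphic function on a complete Reinhardt domain whose components of nonzero weight vanish
is constant, by uniqueness of Fourier coefficients on torus orbits. -/
theorem exists_const_of_weightComponent_eq_zero (hR : IsCompleteReinhardt Ω) (hΩ : IsOpen Ω)
    {g : ℂ × ℂ → ℂ} (hg : DifferentiableOn ℂ g Ω)
    (h0 : ∀ γ : Fin 2 → ℕ, γ ≠ 0 → ∀ z ∈ Ω, weightComponent g (intIndex γ) z = 0) :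
    ∃ c, ∀ z ∈ Ω, g z = c := by
  obtain ⟨c, hc⟩ := exists_weightComponent_eq_monomial hR hΩ hg 0
  refine ⟨c, fun z hz => ?_⟩
  let F : C(UnitAddTorus (Fin 2), ℂ) := ⟨_, hR.continuous_torus_orbit hg hz⟩
  have hF : ∀ δ, δ ≠ 0 → UnitAddTorus.mFourierCoeff F δ = 0 := by
    intro δ hδ
    change weightComponent g δ z = 0
    by_cases hneg : ∃ i, δ i < 0
    · exact weightComponent_eq_zero_of_neg hR hΩ hg hneg hz
    · push Not at hneg
      have hδ' : δ = intIndex fun i => (δ i).toNat := by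
        ext i; simp [intIndex, hneg i]
      rw [hδ']
      refine h0 _ (fun h => hδ ?_) z hz
      rw [hδ', h]; ext i; simp [intIndex]
  have hs : Summable (UnitAddTorus.mFourierCoeff F) :=
    summable_of_ne_finset_zero (s := {0}) fun δ hδ => hF δ (by simpa using hδ)
  have h1 := UnitAddTorus.hasSum_mFourier_series_apply_of_summable hs 0
  have h2 := hasSum_single (f := fun δ => UnitAddTorus.mFourierCoeff F δ • UnitAddTorus.mFourier δ 0)
    0 fun δ hδ => by simp [hF δ hδ]
  have h3 := h1.unique h2
  have h4 : UnitAddTorus.mFourierCoeff F 0 = c := by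
    refine Eq.trans ?_ ((hc z hz).trans ?_)
    · simp only [weightComponent]; congr 1
    · simp [monomial]
  rw [h4, UnitAddTorus.mFourier_zero] at h3
  simpa [F, torusAct_zero] using h3

end Slices

section BoundedReinhardt

variable {Ω : Set (ℂ × ℂ)}

/-! ### Norms of monomials -/

theorem memLp_of_continuous (hΩ : IsOpen Ω) (hb : Bornology.IsBounded Ω)
    {u : ℂ × ℂ → ℂ} (hu : Continuous u) :
    MemLp u 2 ((volume : Measure (ℂ × ℂ)).restrict Ω) := by
  have : IsFiniteMeasure ((volume : Measure (ℂ × ℂ)).restrict Ω) :=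
    ⟨by rw [Measure.restrict_apply_univ]; exact hb.measure_lt_top⟩
  obtain ⟨C, hC⟩ := (hb.isCompact_closure.image hu).isBounded.exists_norm_le
  refine MemLp.of_bound hu.aestronglyMeasurable C ?_
  exact ae_restrict_of_forall_mem hΩ.measurableSet fun z hz =>
    hC _ (Set.mem_image_of_mem u (subset_closure hz))

/-- The square of the norm of the monomial `z ^ α` in `L²(Ω)`. -/
noncomputable def monomialNormSq (Ω : Set (ℂ × ℂ)) (α : Fin 2 → ℕ) : ℝ :=
  ∫ z in Ω, ‖monomial α z‖ ^ 2

theorem integrableOn_norm_sq_monomial (hΩ : IsOpen Ω) (hb : Bornology.IsBounded Ω)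
    (α : Fin 2 → ℕ) :
    IntegrableOn (fun z => ‖monomial α z‖ ^ 2) Ω :=
  (memLp_of_continuous hΩ hb (continuous_monomial α)).integrable_norm_pow (by norm_num)

/-- The norms of `z ^ (β + K γ)` grow at least like the powers of (half of) the value of `|z ^ γ|²`
at a given point of `Ω`. -/
theorem exists_pos_forall_le_monomialNormSq (hΩ : IsOpen Ω) (hb : Bornology.IsBounded Ω)
    {z₀ : ℂ × ℂ} (hz₀ : z₀ ∈ Ω) (h₁ : z₀.1 ≠ 0) (h₂ : z₀.2 ≠ 0) (γ β : Fin 2 → ℕ) :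
    ∃ ε > 0, ∀ K : ℕ, (‖monomial γ z₀‖ ^ 2 / 2) ^ K * ε ≤ monomialNormSq Ω (β + K • γ) := by
  have hγ := norm_pos_iff.mpr (monomial_ne_zero γ h₁ h₂)
  have hβ := norm_pos_iff.mpr (monomial_ne_zero β h₁ h₂)
  set a := ‖monomial γ z₀‖ ^ 2 / 2 with ha
  set b := ‖monomial β z₀‖ ^ 2 / 2 with hb'
  have hapos : 0 < a := by positivity
  have hbpos : 0 < b := by positivity
  have hcγ := continuous_monomial γ
  have hcβ := continuous_monomial β
  set U := Ω ∩ ({z | a < ‖monomial γ z‖ ^ 2} ∩ {z | b < ‖monomial β z‖ ^ 2}) with hU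
  have hUo : IsOpen U := hΩ.inter ((isOpen_lt (by fun_prop) (by fun_prop)).inter
    (isOpen_lt (by fun_prop) (by fun_prop)))
  have hUne : U.Nonempty := 
    ⟨z₀, hz₀, half_lt_self (pow_pos hγ 2), half_lt_self (pow_pos hβ 2)⟩
  have hUfin : volume U < ⊤ := (hb.subset Set.inter_subset_left).measure_lt_top
  have hUpos : 0 < volume.real U :=
    ENNReal.toReal_pos (hUo.measure_pos volume hUne).ne' hUfin.ne
  refine ⟨b * volume.real U, by positivity, fun K => ?_⟩
  have hint := integrableOn_norm_sq_monomial hΩ hb (β + K • γ)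
  calc a ^ K * (b * volume.real U) = ∫ z in U, a ^ K * b := by
        rw [setIntegral_const, smul_eq_mul]; ring
    _ ≤ ∫ z in U, ‖monomial (β + K • γ) z‖ ^ 2 := by
        refine setIntegral_mono_on (integrableOn_const hUfin.ne) (hint.mono_set Set.inter_subset_left)
          hUo.measurableSet fun z hz => ?_
        rw [monomial_add, monomial_nsmul, norm_mul, mul_pow, mul_comm, norm_pow, ← pow_mul,
          mul_comm K, pow_mul]
        exact mul_le_mul (le_of_lt hz.2.2) (pow_le_pow_left₀ hapos.le (le_of_lt hz.2.1) K)
          (by positivity) (by positivity)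
    _ ≤ monomialNormSq Ω (β + K • γ) :=
        setIntegral_mono_set hint (Filter.Eventually.of_forall fun z => by positivity)
          (Filter.Eventually.of_forall fun z hz => hz.1)

theorem monomialNormSq_pos (hR : IsCompleteReinhardt Ω) (hΩ : IsOpen Ω)
    (hb : Bornology.IsBounded Ω) (hne : Ω.Nonempty) (α : Fin 2 → ℕ) :
    0 < monomialNormSq Ω α := by
  obtain ⟨r, hr, hrΩ⟩ := hR.exists_diagonal_mem hΩ hne
  have hr0 : (r : ℂ) ≠ 0 := by exact_mod_cast hr.ne'
  obtain ⟨ε, hε, h⟩ := exists_pos_forall_le_monomialNormSq hΩ hb hrΩ hr0 hr0 0 α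
  have := h 0
  simp only [pow_zero, one_mul, zero_smul, add_zero] at this
  exact hε.trans_le this

/-- Along a chain `β + K γ`, consecutive quotients of the squared norms cannot all stay below
a bound that depends on `γ` only. -/
theorem exists_pos_forall_exists_mul_le (hR : IsCompleteReinhardt Ω) (hΩ : IsOpen Ω)
    (hb : Bornology.IsBounded Ω) (hne : Ω.Nonempty) (γ : Fin 2 → ℕ) :
    ∃ m > 0, ∀ β : Fin 2 → ℕ, ∃ K : ℕ,
      m * monomialNormSq Ω (β + K • γ) ≤ monomialNormSq Ω (β + (K + 1) • γ) := by
  obtain ⟨r, hr, hrΩ⟩ := hR.exists_diagonal_mem hΩ hne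
  have hr0 : (r : ℂ) ≠ 0 := by exact_mod_cast hr.ne'
  have hγ := norm_pos_iff.mpr (monomial_ne_zero γ (z := ((r : ℂ), (r : ℂ))) hr0 hr0)
  refine ⟨‖monomial γ (r, r)‖ ^ 2 / 2 / 2, by positivity, fun β => ?_⟩
  obtain ⟨ε, hε, hlow⟩ := exists_pos_forall_le_monomialNormSq hΩ hb hrΩ hr0 hr0 γ β
  set a := ‖monomial γ (r, r)‖ ^ 2 / 2 with ha
  have hapos : 0 < a := by positivity
  -- Otherwise the norms would grow at most like `(a / 2) ^ K`, but they grow at least like `a ^ K`.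
  by_contra! hcon
  have hup : ∀ K : ℕ, monomialNormSq Ω (β + K • γ) ≤ (a / 2) ^ K * monomialNormSq Ω β := by
    intro K
    induction K with
    | zero => simp
    | succ K ih =>
      calc _ ≤ a / 2 * monomialNormSq Ω (β + K • γ) := (hcon K).le
        _ ≤ a / 2 * ((a / 2) ^ K * monomialNormSq Ω β) := by gcongr
        _ = _ := by ring
  obtain ⟨K, hK⟩ := pow_unbounded_of_one_lt (monomialNormSq Ω β / ε) (one_lt_two)
  have h1 := (hlow K).trans (hup K)
  rw [div_pow a, div_mul_eq_mul_div, le_div_iff₀ (by positivity), mul_assoc] at h1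
  have h2 := le_of_mul_le_mul_left h1 (by positivity)
  rw [div_lt_iff₀ hε] at hK
  linarith

/-- There are infinitely many disjoint chains `β + K γ` starting at multi-indices `β ≱ γ`. -/
theorem exists_injective_chains {γ : Fin 2 → ℕ} (hγ : γ ≠ 0) :
    ∃ β : ℕ → Fin 2 → ℕ, (∀ j, ¬ γ ≤ β j) ∧
      Function.Injective fun p : (_ : ℕ) × ℕ => β p.1 + p.2 • γ := by
  by_cases h0 : γ 0 = 0
  · have h1 : γ 1 ≠ 0 := fun h1 => hγ (by ext i; fin_cases i <;> assumption)
    refine ⟨fun j => ![j, 0], fun j h => h1 (by simpa using h 1), ?_⟩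
    rintro ⟨j, k⟩ ⟨j', k'⟩ h
    have e0 := congrFun h 0
    have e1 := congrFun h 1
    simp [h0, h1] at e0 e1
    simp [e0, e1]
  · refine ⟨fun j => ![0, j], fun j h => h0 (by simpa using h 0), ?_⟩
    rintro ⟨j, k⟩ ⟨j', k'⟩ h
    have e0 := congrFun h 0
    have e1 := congrFun h 1
    simp [h0] at e0 e1
    subst e0
    simpa using e1

end BoundedReinhardt

section Hankel

variable {Ω : Set (ℂ × ℂ)}

/-! ### The Hankel operator on monomials -/

theorem inner_toLp_toLp {μ : Measure (ℂ × ℂ)} {u v : ℂ × ℂ → ℂ} (hu : MemLp u 2 μ)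
    (hv : MemLp v 2 μ) :
    inner ℂ (hu.toLp u) (hv.toLp v) = ∫ z, (starRingEnd ℂ) (u z) * v z ∂μ := by
  rw [L2.inner_def]
  refine integral_congr_ae ?_
  filter_upwards [hu.coeFn_toLp, hv.coeFn_toLp] with z h1 h2
  rw [h1, h2, RCLike.inner_apply, mul_comm]

theorem integrable_conj_mul {μ : Measure (ℂ × ℂ)} {u v : ℂ × ℂ → ℂ} (hu : MemLp u 2 μ)
    (hv : MemLp v 2 μ) : Integrable (fun z => (starRingEnd ℂ) (u z) * v z) μ :=
  hu.star.integrable_mul hv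

/-- The monomial `z ^ α` as an element of the Bergman space. -/
noncomputable def bergmanMonomial (hΩ : IsOpen Ω) (hb : Bornology.IsBounded Ω) (α : Fin 2 → ℕ) :
    bergmanSpace Ω :=
  ⟨(memLp_of_continuous hΩ hb (continuous_monomial α)).toLp (monomial α), monomial α,
    (differentiable_monomial α).differentiableOn, MemLp.coeFn_toLp _⟩

theorem coe_bergmanMonomial (hΩ : IsOpen Ω) (hb : Bornology.IsBounded Ω) (α : Fin 2 → ℕ) :
    (bergmanMonomial hΩ hb α : L2Space Ω) =
      (memLp_of_continuous hΩ hb (continuous_monomial α)).toLp (monomial α) := rfl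

theorem integral_conj_monomial_mul (α : Fin 2 → ℕ) :
    ∫ z in Ω, (starRingEnd ℂ) (monomial α z) * monomial α z = monomialNormSq Ω α := by
  rw [monomialNormSq, ← integral_complex_ofReal]
  refine integral_congr_ae (Filter.Eventually.of_forall fun z => ?_)
  simp [← Complex.normSq_eq_conj_mul_self, Complex.normSq_eq_norm_sq]

theorem intIndex_injective : Function.Injective intIndex := fun α β h => by
  ext i
  exact Int.ofNat_inj.mp (congrFun h i)

theorem inner_bergmanMonomial_self (hΩ : IsOpen Ω) (hb : Bornology.IsBounded Ω)
    (α : Fin 2 → ℕ) :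
    inner ℂ (bergmanMonomial hΩ hb α) (bergmanMonomial hΩ hb α) =
      (monomialNormSq Ω α : ℂ) := by
  rw [Submodule.coe_inner, coe_bergmanMonomial, inner_toLp_toLp, integral_conj_monomial_mul]

theorem inner_bergmanMonomial_of_ne (hR : IsCompleteReinhardt Ω) (hΩ : IsOpen Ω)
    (hb : Bornology.IsBounded Ω) {α β : Fin 2 → ℕ} (h : α ≠ β) :
    inner ℂ (bergmanMonomial hΩ hb α) (bergmanMonomial hΩ hb β) = 0 := by
  rw [Submodule.coe_inner, coe_bergmanMonomial, coe_bergmanMonomial, inner_toLp_toLp]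
  exact (hasWeight_monomial α).integral_conj_mul_eq_zero hR hΩ.measurableSet
    (intIndex_injective.ne h) (hasWeight_monomial β)
    (integrable_conj_mul (memLp_of_continuous hΩ hb (continuous_monomial α))
      (memLp_of_continuous hΩ hb (continuous_monomial β)))

/-- The normalized monomials are orthonormal in the Bergman space. -/
theorem orthonormal_bergmanMonomial (hR : IsCompleteReinhardt Ω) (hΩ : IsOpen Ω)
    (hb : Bornology.IsBounded Ω) (hne : Ω.Nonempty) :
    Orthonormal ℂ fun α =>
      (((√(monomialNormSq Ω α))⁻¹ : ℝ) : ℂ) • bergmanMonomial hΩ hb α := by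
  classical
  rw [orthonormal_iff_ite]
  intro α β
  rw [Submodule.coe_inner, Submodule.coe_smul, Submodule.coe_smul, inner_smul_left,
    inner_smul_right, Complex.conj_ofReal, ← Submodule.coe_inner]
  split_ifs with h
  · subst h
    have hpos := monomialNormSq_pos hR hΩ hb hne α
    rw [inner_bergmanMonomial_self, ← Complex.ofReal_mul, ← Complex.ofReal_mul, ← mul_assoc,
      ← mul_inv, Real.mul_self_sqrt hpos.le, inv_mul_cancel₀ hpos.ne', Complex.ofReal_one]
  · rw [inner_bergmanMonomial_of_ne hR hΩ hb h, mul_zero, mul_zero]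

/-- A function of weight `δ` is orthogonal to the Bergman space as soon as it is orthogonal to the
monomial of weight `δ`, if there is one. -/
theorem inner_eq_zero_of_mem_bergmanSpace (hR : IsCompleteReinhardt Ω) (hΩ : IsOpen Ω)
    {δ : Fin 2 → ℤ} {u : ℂ × ℂ → ℂ}
    (hu : MemLp u 2 ((volume : Measure (ℂ × ℂ)).restrict Ω)) (hw : HasWeight δ u)
    (h0 : ∀ ν, δ = intIndex ν → ∫ z in Ω, (starRingEnd ℂ) (u z) * monomial ν z = 0)
    {g : L2Space Ω} (hg : g ∈ bergmanSpace Ω) : inner ℂ (hu.toLp u) g = 0 := by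
  obtain ⟨F, hF, hgF⟩ := hg
  have hFm : MemLp F 2 ((volume : Measure (ℂ × ℂ)).restrict Ω) := (Lp.memLp g).ae_eq hgF
  have hgeq : g = hFm.toLp F := Lp.ext (hgF.trans hFm.coeFn_toLp.symm)
  rw [hgeq, inner_toLp_toLp,
    hw.integral_conj_mul hR hΩ.measurableSet (integrable_conj_mul hu hFm)]
  by_cases hneg : ∃ i, δ i < 0
  · rw [setIntegral_congr_fun (g := fun _ => (0 : ℂ)) hΩ.measurableSet fun z hz => by
      simp only [weightComponent_eq_zero_of_neg hR hΩ hF hneg hz, mul_zero]]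
    simp
  · push Not at hneg
    have hδ : δ = intIndex fun i => (δ i).toNat := by
      ext i; simp [intIndex, hneg i]
    obtain ⟨c, hc⟩ := exists_weightComponent_eq_monomial hR hΩ hF fun i => (δ i).toNat
    rw [← hδ] at hc
    rw [setIntegral_congr_fun hΩ.measurableSet fun z hz => by
      simp only [hc z hz, mul_left_comm _ c]; rfl, integral_const_mul, h0 _ hδ, mul_zero]

theorem memLp_mul_bergmanMonomial (hΩ : IsOpen Ω) (hb : Bornology.IsBounded Ω)
    {f : ℂ × ℂ → ℂ} (hf : MemBergman Ω f) (α : Fin 2 → ℕ) :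
    MemLp (fun z => (starRingEnd ℂ) (f z) * monomial α z) 2
      ((volume : Measure (ℂ × ℂ)).restrict Ω) := by
  obtain ⟨C, hC⟩ :=
    (hb.isCompact_closure.image (continuous_monomial α)).isBounded.exists_norm_le
  refine MemLp.of_le_mul (c := C) hf.2 ?_ ?_
  · exact hf.2.star.1.mul (continuous_monomial α).aestronglyMeasurable
  · refine ae_restrict_of_forall_mem hΩ.measurableSet fun z hz => ?_
    rw [norm_mul, RCLike.norm_conj, mul_comm]
    exact mul_le_mul_of_nonneg_right (hC _ (Set.mem_image_of_mem _ (subset_closure hz)))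
      (norm_nonneg _)

theorem bergmanMonomial_mem_domain (hΩ : IsOpen Ω) (hb : Bornology.IsBounded Ω)
    {f : ℂ × ℂ → ℂ} (hf : MemBergman Ω f) (α : Fin 2 → ℕ) :
    bergmanMonomial hΩ hb α ∈
      (hankelOperator Ω (fun z => (starRingEnd ℂ) (f z))).domain := by
  refine (memLp_mul_bergmanMonomial hΩ hb hf α).ae_eq ?_
  filter_upwards [(memLp_of_continuous hΩ hb (continuous_monomial α)).coeFn_toLp] with z hz
  rw [coe_bergmanMonomial, hz]

/-- The Bergman projection is invisible to vectors orthogonal to the Bergman space. -/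
theorem inner_hankelOperator_bergmanMonomial (hΩ : IsOpen Ω) (hb : Bornology.IsBounded Ω)
    {f : ℂ × ℂ → ℂ} (hf : MemBergman Ω f) (α : Fin 2 → ℕ) {U : L2Space Ω}
    (hU : ∀ g ∈ bergmanSpace Ω, inner ℂ U g = 0) :
    inner ℂ U (hankelOperator Ω (fun z => (starRingEnd ℂ) (f z))
        ⟨bergmanMonomial hΩ hb α, bergmanMonomial_mem_domain hΩ hb hf α⟩) =
      inner ℂ U ((memLp_mul_bergmanMonomial hΩ hb hf α).toLp _) := by
  have hU' : U ∈ (bergmanSpace Ω).topologicalClosureᗮ := by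
    rw [Submodule.orthogonal_closure]
    exact (Submodule.mem_orthogonal' _ _).mpr hU
  have hval : hankelOperator Ω (fun z => (starRingEnd ℂ) (f z))
      ⟨bergmanMonomial hΩ hb α, bergmanMonomial_mem_domain hΩ hb hf α⟩ =
      (memLp_mul_bergmanMonomial hΩ hb hf α).toLp _ -
        bergmanProjection Ω ((memLp_mul_bergmanMonomial hΩ hb hf α).toLp _) := by
    have hm : mulSymbol Ω (fun z => (starRingEnd ℂ) (f z))
        ⟨bergmanMonomial hΩ hb α, bergmanMonomial_mem_domain hΩ hb hf α⟩ =
        (memLp_mul_bergmanMonomial hΩ hb hf α).toLp _ := by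
      refine MemLp.toLp_congr (memLp_of_mem_mulDomain (bergmanMonomial_mem_domain hΩ hb hf α))
        (memLp_mul_bergmanMonomial hΩ hb hf α) ?_
      filter_upwards [(memLp_of_continuous hΩ hb (continuous_monomial α)).coeFn_toLp] with z hz
      rw [coe_bergmanMonomial, hz]
    rw [← hm]; rfl
  have hP : inner ℂ U (bergmanProjection Ω
      ((memLp_mul_bergmanMonomial hΩ hb hf α).toLp _)) = 0 :=
    (Submodule.mem_orthogonal' _ _).mp hU' _ (Submodule.starProjection_apply_mem _ _)
  rw [hval, inner_sub_right, hP, sub_zero]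

/-- If `u`, of weight `α - γ`, is orthogonal to the Bergman space and has the same pairing with
`conj (z ^ γ) * z ^ α` as with itself, then it detects the `γ`-th coefficient `c` of `f`. -/
theorem norm_sq_hankelOperator_ge (hR : IsCompleteReinhardt Ω) (hΩ : IsOpen Ω)
    (hb : Bornology.IsBounded Ω) {f : ℂ × ℂ → ℂ} (hf : MemBergman Ω f) {α γ : Fin 2 → ℕ} {c : ℂ}
    (hc : ∀ z ∈ Ω, weightComponent f (intIndex γ) z = c * monomial γ z) {u : ℂ × ℂ → ℂ}
    (hu : Continuous u) (hw : HasWeight (intIndex α - intIndex γ) u)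
    (h0 : ∀ ν, intIndex α - intIndex γ = intIndex ν →
      ∫ z in Ω, (starRingEnd ℂ) (u z) * monomial ν z = 0) {w : ℝ}
    (hself : ∫ z in Ω, (starRingEnd ℂ) (u z) * u z = w)
    (hpair : ∫ z in Ω, (starRingEnd ℂ) (u z) *
      ((starRingEnd ℂ) (monomial γ z) * monomial α z) = w) :
    ‖c‖ ^ 2 * w ≤ ‖hankelOperator Ω (fun z => (starRingEnd ℂ) (f z))
        ⟨bergmanMonomial hΩ hb α, bergmanMonomial_mem_domain hΩ hb hf α⟩‖ ^ 2 := by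
  have hum := memLp_of_continuous hΩ hb hu
  set U := hum.toLp u with hU
  have hortho : ∀ g ∈ bergmanSpace Ω, inner ℂ U g = 0 := fun g hg =>
    inner_eq_zero_of_mem_bergmanSpace hR hΩ hum hw h0 hg
  have hUU : inner ℂ U U = (w : ℂ) := by rw [hU, inner_toLp_toLp, hself]
  have hUnorm : ‖U‖ ^ 2 = w := by
    rw [inner_self_eq_norm_sq_to_K] at hUU
    exact Complex.ofReal_injective (by rw [← hUU]; simp)
  have key := inner_hankelOperator_bergmanMonomial hΩ hb hf α hortho
  generalize hankelOperator Ω (fun z => (starRingEnd ℂ) (f z))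
    ⟨bergmanMonomial hΩ hb α, bergmanMonomial_mem_domain hΩ hb hf α⟩ = X at key ⊢
  -- `conj u * conj f * z ^ α` is the conjugate of `conj h * f`, with `h` of weight `γ`.
  have hh : HasWeight (intIndex γ) fun z => (starRingEnd ℂ) (u z) * monomial α z := by
    have := hw.conj.mul (hasWeight_monomial α)
    rwa [neg_sub, sub_add_cancel] at this
  have hhc : Continuous fun z => (starRingEnd ℂ) (u z) * monomial α z :=
    (Complex.continuous_conj.comp hu).mul (continuous_monomial α)
  have hpair' := congrArg (starRingEnd ℂ) hpair
  rw [← integral_conj, Complex.conj_ofReal] at hpair'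
  have hval : inner ℂ U X = (starRingEnd ℂ) c * w := by
    rw [key, hU, inner_toLp_toLp]
    have h1 := hh.integral_conj_mul hR hΩ.measurableSet
      (integrable_conj_mul (memLp_of_continuous hΩ hb hhc) hf.2)
    rw [setIntegral_congr_fun (f := fun z => (starRingEnd ℂ)
        ((starRingEnd ℂ) (u z) * monomial α z) * weightComponent f (intIndex γ) z)
        (g := fun z => c * (starRingEnd ℂ) ((starRingEnd ℂ) (u z) *
          ((starRingEnd ℂ) (monomial γ z) * monomial α z))) hΩ.measurableSet
        fun z hz => by
          simp only [hc z hz, map_mul, Complex.conj_conj]; ring,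
      integral_const_mul, hpair'] at h1
    have h2 := congrArg (starRingEnd ℂ) h1
    rw [← integral_conj, map_mul, Complex.conj_ofReal] at h2
    rw [← h2]
    refine integral_congr_ae (Filter.Eventually.of_forall fun z => ?_)
    simp only [map_mul, Complex.conj_conj]; ring
  have hCS := norm_inner_le_norm (𝕜 := ℂ) U X
  rw [hval, norm_mul, RCLike.norm_conj, Complex.norm_real, Real.norm_eq_abs, ← hUnorm,
    abs_of_nonneg (by positivity)] at hCS
  rw [← hUnorm]
  -- Cauchy–Schwarz reads `‖c‖ * ‖U‖ ^ 2 ≤ ‖U‖ * ‖X‖`; the case `U = 0` is trivial.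
  rcases (norm_nonneg U).eq_or_lt with h | h
  · rw [← h]; simp
  · have h3 : ‖c‖ * ‖U‖ ≤ ‖X‖ := by
      refine le_of_mul_le_mul_left ?_ h
      linarith [hCS, sq ‖U‖]
    calc ‖c‖ ^ 2 * ‖U‖ ^ 2 = (‖c‖ * ‖U‖) ^ 2 := by ring
      _ ≤ ‖X‖ ^ 2 := by gcongr

theorem integral_conj_mul_self_conj_monomial (α γ : Fin 2 → ℕ) :
    ∫ z in Ω, (starRingEnd ℂ) ((starRingEnd ℂ) (monomial γ z) * monomial α z) *
      ((starRingEnd ℂ) (monomial γ z) * monomial α z) = monomialNormSq Ω (α + γ) := by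
  rw [← integral_conj_monomial_mul]
  refine integral_congr_ae (Filter.Eventually.of_forall fun z => ?_)
  simp only [monomial_add, map_mul, Complex.conj_conj]; ring

theorem continuous_conj_monomial_mul (α γ : Fin 2 → ℕ) :
    Continuous fun z => (starRingEnd ℂ) (monomial γ z) * monomial α z :=
  (Complex.continuous_conj.comp (continuous_monomial γ)).mul (continuous_monomial α)

theorem hasWeight_conj_monomial_mul (α γ : Fin 2 → ℕ) :
    HasWeight (intIndex α - intIndex γ)
      fun z => (starRingEnd ℂ) (monomial γ z) * monomial α z := by
  have := (hasWeight_monomial γ).conj.mul (hasWeight_monomial α)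
  rwa [neg_add_eq_sub] at this

/-- For `α ≱ γ`, the function `conj (z ^ γ) * z ^ α` is itself orthogonal to the Bergman space. -/
theorem norm_sq_hankelOperator_ge_of_not_le (hR : IsCompleteReinhardt Ω) (hΩ : IsOpen Ω)
    (hb : Bornology.IsBounded Ω) {f : ℂ × ℂ → ℂ} (hf : MemBergman Ω f) {α γ : Fin 2 → ℕ} {c : ℂ}
    (hc : ∀ z ∈ Ω, weightComponent f (intIndex γ) z = c * monomial γ z) (hαγ : ¬ γ ≤ α) :
    ‖c‖ ^ 2 * monomialNormSq Ω (α + γ) ≤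
      ‖hankelOperator Ω (fun z => (starRingEnd ℂ) (f z))
        ⟨bergmanMonomial hΩ hb α, bergmanMonomial_mem_domain hΩ hb hf α⟩‖ ^ 2 := by
  refine norm_sq_hankelOperator_ge hR hΩ hb hf hc (continuous_conj_monomial_mul α γ)
    (hasWeight_conj_monomial_mul α γ) (fun ν hν => (hαγ fun i => ?_).elim)
    (integral_conj_mul_self_conj_monomial α γ) (integral_conj_mul_self_conj_monomial α γ)
  have := congrFun hν i
  simp only [intIndex, Pi.sub_apply] at this
  change γ i ≤ α i
  omega

/-- For `α = δ + γ`, the function `conj (z ^ γ) * z ^ α` has to be corrected by its projection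
to the Bergman space, which is a multiple of `z ^ δ`. -/
theorem norm_sq_hankelOperator_ge_of_add (hR : IsCompleteReinhardt Ω) (hΩ : IsOpen Ω)
    (hb : Bornology.IsBounded Ω) (hne : Ω.Nonempty) {f : ℂ × ℂ → ℂ} (hf : MemBergman Ω f)
    {δ γ : Fin 2 → ℕ} {c : ℂ}
    (hc : ∀ z ∈ Ω, weightComponent f (intIndex γ) z = c * monomial γ z) :
    ‖c‖ ^ 2 * (monomialNormSq Ω (δ + γ + γ) -
        monomialNormSq Ω (δ + γ) ^ 2 / monomialNormSq Ω δ) ≤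
      ‖hankelOperator Ω (fun z => (starRingEnd ℂ) (f z))
        ⟨bergmanMonomial hΩ hb (δ + γ), bergmanMonomial_mem_domain hΩ hb hf (δ + γ)⟩‖ ^ 2 := by
  have hδ := monomialNormSq_pos hR hΩ hb hne δ
  -- `r` is the coefficient of that projection.
  set r : ℝ := monomialNormSq Ω (δ + γ) / monomialNormSq Ω δ with hr
  set v : ℂ × ℂ → ℂ := fun z => (starRingEnd ℂ) (monomial γ z) * monomial (δ + γ) z with hv
  have hvc : Continuous v := continuous_conj_monomial_mul _ _
  have hwt : intIndex (δ + γ) - intIndex γ = intIndex δ := by ext i; simp [intIndex]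
  have hvw := hasWeight_conj_monomial_mul (δ + γ) γ
  have hvm := memLp_of_continuous hΩ hb hvc
  have hdm := memLp_of_continuous hΩ hb (continuous_monomial δ)
  have hvv : ∫ z in Ω, (starRingEnd ℂ) (v z) * v z = monomialNormSq Ω (δ + γ + γ) :=
    integral_conj_mul_self_conj_monomial _ _
  have hvd : ∫ z in Ω, (starRingEnd ℂ) (v z) * monomial δ z = monomialNormSq Ω (δ + γ) := by
    rw [← integral_conj_monomial_mul]
    refine integral_congr_ae (Filter.Eventually.of_forall fun z => ?_)
    simp only [hv, monomial_add, map_mul, Complex.conj_conj]; ring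
  have hdv : ∫ z in Ω, (starRingEnd ℂ) (monomial δ z) * v z = monomialNormSq Ω (δ + γ) := by
    rw [← integral_conj_monomial_mul]
    refine integral_congr_ae (Filter.Eventually.of_forall fun z => ?_)
    simp only [hv, monomial_add, map_mul]; ring
  have hrδ : (r : ℂ) * monomialNormSq Ω δ = monomialNormSq Ω (δ + γ) := by
    rw [← Complex.ofReal_mul, hr, div_mul_cancel₀ _ hδ.ne']
  set u : ℂ × ℂ → ℂ := fun z => v z - r * monomial δ z with hu
  have hud : ∫ z in Ω, (starRingEnd ℂ) (u z) * monomial δ z = 0 := by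
    have : ∀ z, (starRingEnd ℂ) (u z) * monomial δ z =
        (starRingEnd ℂ) (v z) * monomial δ z -
          r * ((starRingEnd ℂ) (monomial δ z) * monomial δ z) := by
      intro z; simp only [hu, map_sub, map_mul, Complex.conj_ofReal]; ring
    simp_rw [this]
    rw [integral_sub (integrable_conj_mul hvm hdm)
      ((integrable_conj_mul hdm hdm).const_mul _), integral_const_mul, hvd,
      integral_conj_monomial_mul, hrδ, sub_self]
  have huc : Continuous u := hvc.sub (continuous_const.mul (continuous_monomial δ))
  have hum := memLp_of_continuous hΩ hb huc
  have huv : ∫ z in Ω, (starRingEnd ℂ) (u z) * v z =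
      ((monomialNormSq Ω (δ + γ + γ) -
        monomialNormSq Ω (δ + γ) ^ 2 / monomialNormSq Ω δ : ℝ) : ℂ) := by
    have : ∀ z, (starRingEnd ℂ) (u z) * v z =
        (starRingEnd ℂ) (v z) * v z - r * ((starRingEnd ℂ) (monomial δ z) * v z) := by
      intro z; simp only [hu, map_sub, map_mul, Complex.conj_ofReal]; ring
    simp_rw [this]
    rw [integral_sub (integrable_conj_mul hvm hvm)
      ((integrable_conj_mul hdm hvm).const_mul _), integral_const_mul, hvv, hdv, hr]
    push_cast; ring
  have huu : ∫ z in Ω, (starRingEnd ℂ) (u z) * u z =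
      ∫ z in Ω, (starRingEnd ℂ) (u z) * v z := by
    have : ∀ z, (starRingEnd ℂ) (u z) * u z =
        (starRingEnd ℂ) (u z) * v z - r * ((starRingEnd ℂ) (u z) * monomial δ z) := by
      intro z; simp only [hu]; ring
    rw [integral_congr_ae (Filter.Eventually.of_forall this),
      integral_sub (integrable_conj_mul hum hvm)
      ((integrable_conj_mul hum hdm).const_mul _), integral_const_mul, hud, mul_zero, sub_zero]
  refine norm_sq_hankelOperator_ge hR hΩ hb hf hc huc
    (hvw.sub (by rw [hwt]; exact (hasWeight_monomial δ).const_mul _)) ?_ (huu.trans huv) huv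
  intro ν hν
  rw [hwt] at hν
  rw [← intIndex_injective hν]
  exact hud

/-! ### Divergence of the Hilbert–Schmidt sum -/

/-- On a bounded complete Reinhardt domain, a Hilbert–Schmidt Hankel operator with
antiholomorphic symbol `conj f` forces every coefficient of `f` of nonzero degree to vanish: each
chain `β + k γ` contributes a telescoping sum bounded below independently of `β`. -/
theorem weightComponent_eq_zero_of_isHilbertSchmidtPartial (hR : IsCompleteReinhardt Ω)
    (hΩ : IsOpen Ω) (hb : Bornology.IsBounded Ω) {f : ℂ × ℂ → ℂ} (hf : MemBergman Ω f)
    (hH : IsHilbertSchmidtPartial (hankelOperator Ω (fun z => (starRingEnd ℂ) (f z))))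
    {γ : Fin 2 → ℕ} (hγ : γ ≠ 0) {z : ℂ × ℂ} (hz : z ∈ Ω) :
    weightComponent f (intIndex γ) z = 0 := by
  have hne : Ω.Nonempty := ⟨z, hz⟩
  obtain ⟨c, hc⟩ := exists_weightComponent_eq_monomial hR hΩ hf.1 γ
  suffices hc0 : ‖c‖ ^ 2 = 0 by
    rw [hc z hz, norm_eq_zero.mp (pow_eq_zero_iff two_ne_zero |>.mp hc0), zero_mul]
  obtain ⟨T, hT, ι, ξ, hξ⟩ := hH
  obtain ⟨β, hβ, hinj⟩ := exists_injective_chains hγ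
  obtain ⟨m, hm, hK⟩ := exists_pos_forall_exists_mul_le hR hΩ hb hne γ
  choose K hK using fun j => hK (β j)
  set n := monomialNormSq Ω with hn
  have hnpos : ∀ α, 0 < n α := monomialNormSq_pos hR hΩ hb hne
  set e : (Fin 2 → ℕ) → bergmanSpace Ω := fun α =>
    (((√(n α))⁻¹ : ℝ) : ℂ) • bergmanMonomial hΩ hb α with he
  have heT : ∀ α, ‖T (e α)‖ ^ 2 = ‖T (bergmanMonomial hΩ hb α)‖ ^ 2 / n α := by
    intro α
    rw [he, map_smul, norm_smul, mul_pow, Complex.norm_real, Real.norm_eq_abs, sq_abs, inv_pow,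
      Real.sq_sqrt (hnpos α).le]
    ring
  have hTM : ∀ α, T (bergmanMonomial hΩ hb α) =
      hankelOperator Ω (fun z => (starRingEnd ℂ) (f z))
        ⟨bergmanMonomial hΩ hb α, bergmanMonomial_mem_domain hΩ hb hf α⟩ :=
    fun α => hT ⟨bergmanMonomial hΩ hb α, bergmanMonomial_mem_domain hΩ hb hf α⟩
  -- The terms of the chain `β j + k • γ` dominate the increments of
  -- `n (β j + (k + 1) • γ) / n (β j + k • γ)`.
  have hfirst : ∀ j, ‖c‖ ^ 2 * (n (β j + γ) / n (β j)) ≤ ‖T (e (β j))‖ ^ 2 := by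
    intro j
    rw [heT, hTM, ← mul_div_assoc]
    have := hnpos (β j)
    gcongr
    exact norm_sq_hankelOperator_ge_of_not_le hR hΩ hb hf hc (hβ j)
  have hstep : ∀ δ, ‖c‖ ^ 2 * (n (δ + γ + γ) / n (δ + γ) - n (δ + γ) / n δ) ≤
      ‖T (e (δ + γ))‖ ^ 2 := by
    intro δ
    have h1 := norm_sq_hankelOperator_ge_of_add hR hΩ hb hne hf (δ := δ) hc
    have hp := hnpos (δ + γ)
    have hp' := hnpos δ
    rw [heT, hTM, le_div_iff₀ hp]
    refine le_trans (le_of_eq ?_) h1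
    rw [← hn]
    field_simp
  have htel : ∀ j k, ‖c‖ ^ 2 * (n (β j + (k + 1) • γ) / n (β j + k • γ)) ≤
      ∑ i ∈ Finset.range (k + 1), ‖T (e (β j + i • γ))‖ ^ 2 := by
    intro j k
    induction k with
    | zero => simpa using hfirst j
    | succ k ih =>
      rw [Finset.sum_range_succ]
      have h2 := hstep (β j + k • γ)
      simp only [succ_nsmul, ← add_assoc] at ih h2 ⊢
      linarith
  have hchain : ∀ j, ‖c‖ ^ 2 * m ≤
      ∑ i ∈ Finset.range (K j + 1), ‖T (e (β j + i • γ))‖ ^ 2 := by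
    intro j
    refine le_trans ?_ (htel j (K j))
    gcongr
    exact (le_div_iff₀ (hnpos _)).mpr (hK j)
  have horth := (orthonormal_bergmanMonomial hR hΩ hb hne).comp _ hinj
  have hsum : ∀ N : ℕ, N * (‖c‖ ^ 2 * m) ≤ ∑' j, ‖T (ξ j)‖ ^ 2 := by
    intro N
    refine le_trans ?_ (sum_norm_sq_le_of_hilbertBasis T ξ hξ horth
      ((Finset.range N).sigma fun j => Finset.range (K j + 1)))
    rw [Finset.sum_sigma]
    refine le_trans ?_ (Finset.sum_le_sum fun j _ => hchain j)
    simp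
  by_contra hcne
  have hpos : 0 < ‖c‖ ^ 2 * m := mul_pos (lt_of_le_of_ne (by positivity) (Ne.symm hcne)) hm
  obtain ⟨N, hN⟩ := exists_nat_gt ((∑' j, ‖T (ξ j)‖ ^ 2) / (‖c‖ ^ 2 * m))
  rw [div_lt_iff₀ hpos] at hN
  exact absurd (hsum N) (not_le.mpr hN)

end Hankel

/-! ### Conclusion for Hartogs domains over the disc -/

/-- By completeness, `|z₂| < exp (-φ 0)` on the whole domain. -/
theorem isBounded_hartogsDomain {φ : ℝ → ℝ} (hR : IsCompleteReinhardt (hartogsDomain φ)) :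
    Bornology.IsBounded (hartogsDomain φ) := by
  refine (Metric.isBounded_closedBall (x := (0 : ℂ × ℂ))
    (r := max 1 (Real.exp (-φ 0)))).subset fun z hz => ?_
  have h0 : ((0 : ℂ), z.2) ∈ hartogsDomain φ := hR z hz _ (by simp) le_rfl
  rw [mem_closedBall_zero_iff, Prod.norm_def]
  refine max_le_max hz.1.le ?_
  simpa using h0.2.le

theorem theorem1 (φ : ℝ → ℝ) (hφ : ContDiffOn ℝ 2 φ (Set.Ico 0 1))
    (hR : IsCompleteReinhardt (hartogsDomain φ)) (hP : IsPseudoconvex (hartogsDomain φ))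
    (f : ℂ × ℂ → ℂ) (hf : MemBergman (hartogsDomain φ) f)
    (hH : IsHilbertSchmidtPartial
      (hankelOperator (hartogsDomain φ) (fun z => (starRingEnd ℂ) (f z)))) :
    ∃ c : ℂ, ∀ z ∈ hartogsDomain φ, f z = c :=
  exists_const_of_weightComponent_eq_zero hR hP.1 hf.1 fun _ hγ _ hz =>
    weightComponent_eq_zero_of_isHilbertSchmidtPartial hR hP.1 (isBounded_hartogsDomain hR) hf hH
      hγ hz
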